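/- Consider two base stations (BSs) $i\in\{1,2\}$; write $\bar\imath$ for the other one. Let $\mathcal K_1,\mathcal K_2$ be disjoint finite sets of terminals and let $W_i>0$, $\bar E_i\ge 0$, $P_{c,i}\ge 0$, $\alpha_i^E>0$, $\alpha_i^G>0$, $\gamma_i>0$, $0\le\beta_E\le 1$, $\beta_B\in\{0,1\}$, $N_0>0$, and $g_k>0$, $r_k>0$ for $k\in\mathcal K_1\cup\mathcal K_2$. Let (P1) be the problem of minimizing $\sum_{i}\gamma_i(\alpha_i^E E_i+\alpha_i^G G_i)$ over nonnegative $E_i,G_i,e_i,w_i,b_k,p_k$ subject to $$\sum_{k\in\mathcal K_i}p_k+P_{c,i}\le E_i+G_i+\beta_E e_{\bar\imath}-e_i\quad\text{(power)},\qquad \sum_{k\in\mathcal K_i}b_k\le W_i+\beta_B w_{\bar\imath}-w_i\quad\text{(bandwidth)},$$ $$E_i\le\bar E_i\quad(i\in\{1,2\}),\qquad b_k\log_2\Bigl(1+\frac{g_kp_k}{b_kN_0}\Bigr)\ge r_k\quad(k\in\mathcal K_1\cup\mathcal K_2),$$ where the left-hand side of the last constraint is $0$ when $b_k=0$. Let the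 Lagrange dual of (P1) be formed by attaching multipliers $\mu_i\ge0$ to the power constraints and $\lambda_i\ge 0$ to the bandwidth constraints, all other constraints being kept. Let $\mathcal W$ be the principal branch of the Lambert function, i.e. for $x\ge -1/e$, $\mathcal W(x)$ is the unique $w\ge -1$ with $we^w=x$. Then (P1) has an optimal solution and the dual problem has an optimal solution. Let $(\lambda^\star,\mu^\star)$ be any optimal solution of the dual. (a) Every optimal solution $(E^\star,G^\star,e^\star,w^\star,b^\star,p^\star)$ of (P1) satisfies, for each $i$ and each $k\in\mathcal K_i$, $\mu_i^\star>0$ and $$b_k^\star=\frac{\ln 2\cdot r_k}{\mathcal W\bigl(\frac1e\bigl(\frac{\lambda_i^\star g_k}{\mu_i^\star N_0}-1\bigr)\bigr)+1},\qquad p_k^\star=\frac{b_k^\star N_0}{g_k}\bigl(2^{r_k/b_k^\star}-1\bigr);$$ moreover $(E^\star,G^\star,e^\star)$ solves the linear program $$\text{(P3)}\quad \min_{E,G,e}\ \sum_i\gamma_i(\alpha_i^E E_i+\alpha_i^G G_i)\quad\text{s.t.}\quad \sum_{k\in\mathcal K_i}p_k^\star+P_{c,i}=E_i+G_i+\beta_E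 e_{\bar\imath}-e_i,\ \ 0\le E_i\le\bar E_i,\ G_i\ge0,\ e_i\ge0\ \ (i\in\{1,2\}),$$ and if $w_1^\star w_2^\star=0$, then $w_i^\star=\max\bigl(W_i-\sum_{k\in\mathcal K_i}b_k^\star,0\bigr)$ for each $i$ with $\mathcal K_i\neq\emptyset$. (b) Conversely, if $b^\star,p^\star$ are given by the formulas in (a), $w_i^\star=\max\bigl(W_i-\sum_{k\in\mathcal K_i}b_k^\star,0\bigr)$ for $i\in\{1,2\}$, and $(E^\star,G^\star,e^\star)$ solves (P3), then $(E^\star,G^\star,e^\star,w^\star,b^\star,p^\star)$ is an optimal solution of (P1). -/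

import Mathlib

noncomputable section

/-- The principal branch of the Lambert function: for `-1/e ≤ x`, `lambertW x` is the unique
`w ≥ -1` with `w * exp w = x`. -/
def lambertW (x : ℝ) : ℝ :=
  Function.invFunOn (fun w : ℝ => w * Real.exp w) (Set.Ici (-1)) x

/-- The base station other than `i` (in `Fin 2`, adding one swaps the two elements). -/
def otherBS (i : Fin 2) : Fin 2 := i + 1

/-- Data of two cooperating cellular systems. `K i` is the set of mobile terminals of base
station `i`. -/
structure CoopNetwork (K : Fin 2 → Type*) where
  /-- available bandwidth -/
  W : Fin 2 → ℝ
  /-- maximum purchasable renewable energy -/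
  Ebar : Fin 2 → ℝ
  /-- constant non-transmission power -/
  Pc : Fin 2 → ℝ
  /-- unit price of renewable energy -/
  alphaE : Fin 2 → ℝ
  /-- unit price of grid energy -/
  alphaG : Fin 2 → ℝ
  /-- cost weights -/
  gam : Fin 2 → ℝ
  /-- energy transfer efficiency -/
  betaE : ℝ
  /-- spectrum cooperation factor -/
  betaB : ℝ
  /-- noise power spectral density -/
  N0 : ℝ
  /-- channel gains -/
  g : ∀ i, K i → ℝ
  /-- rate requirements -/
  r : ∀ i, K i → ℝ

/-- The decision variables of the joint problem: renewable energy `E`, grid energy `G`, energy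
transferred to the other base station `e`, bandwidth shared with the other base station `w`,
bandwidth allocation `b` and power allocation `p`. -/
structure CoopDecision (K : Fin 2 → Type*) where
  E : Fin 2 → ℝ
  G : Fin 2 → ℝ
  e : Fin 2 → ℝ
  w : Fin 2 → ℝ
  b : ∀ i, K i → ℝ
  p : ∀ i, K i → ℝ

namespace CoopNetwork

variable {K : Fin 2 → Type*} [∀ i, Fintype (K i)]

/-- Weighted sum cost of the energy purchases `E`, `G`. -/
def cost (N : CoopNetwork K) (E G : Fin 2 → ℝ) : ℝ :=
  ∑ i, N.gam i * (N.alphaE i * E i + N.alphaG i * G i)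

/-- The constraints of the joint problem other than the power and bandwidth constraints:
nonnegativity, the renewable energy caps and the rate requirements. With `b = 0` the rate
`b * log₂ (1 + g p / (b N0))` evaluates to `0`. -/
structure InDomain (N : CoopNetwork K) (x : CoopDecision K) : Prop where
  E_nonneg : ∀ i, 0 ≤ x.E i
  G_nonneg : ∀ i, 0 ≤ x.G i
  e_nonneg : ∀ i, 0 ≤ x.e i
  w_nonneg : ∀ i, 0 ≤ x.w i
  b_nonneg : ∀ i k, 0 ≤ x.b i k
  p_nonneg : ∀ i k, 0 ≤ x.p i k
  E_le : ∀ i, x.E i ≤ N.Ebar i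
  rate : ∀ i k,
    N.r i k ≤ x.b i k * Real.logb 2 (1 + N.g i k * x.p i k / (x.b i k * N.N0))

/-- Power demand minus power supply at base station `i`. -/
def powerExcess (N : CoopNetwork K) (x : CoopDecision K) (i : Fin 2) : ℝ :=
  (∑ k, x.p i k) + N.Pc i - (x.E i + x.G i + N.betaE * x.e (otherBS i) - x.e i)

/-- Bandwidth demand minus bandwidth supply at base station `i`. -/
def bandExcess (N : CoopNetwork K) (x : CoopDecision K) (i : Fin 2) : ℝ :=
  (∑ k, x.b i k) - (N.W i + N.betaB * x.w (otherBS i) - x.w i)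

/-- Feasibility for the joint problem. -/
structure IsFeasible (N : CoopNetwork K) (x : CoopDecision K) : Prop where
  inDomain : N.InDomain x
  power : ∀ i, N.powerExcess x i ≤ 0
  band : ∀ i, N.bandExcess x i ≤ 0

/-- Optimality for the joint problem (global minimizer of the weighted sum cost). -/
def IsOptimal (N : CoopNetwork K) (x : CoopDecision K) : Prop :=
  N.IsFeasible x ∧ ∀ y, N.IsFeasible y → N.cost x.E x.G ≤ N.cost y.E y.G

/-- Partial Lagrangian: `lam i` is the multiplier of the bandwidth constraint and `mu i` the
multiplier of the power constraint of base station `i`. -/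
def lagrangian (N : CoopNetwork K) (lam mu : Fin 2 → ℝ) (x : CoopDecision K) : ℝ :=
  N.cost x.E x.G + (∑ i, mu i * N.powerExcess x i) + ∑ i, lam i * N.bandExcess x i

/-- Lagrange dual function (with value `⊥` where the Lagrangian is unbounded below). -/
def dualFun (N : CoopNetwork K) (lam mu : Fin 2 → ℝ) : EReal :=
  ⨅ x : {x : CoopDecision K // N.InDomain x}, ((N.lagrangian lam mu x.1 : ℝ) : EReal)

/-- `(lam, mu)` are optimal dual variables: nonnegative and maximizing the dual function. -/
def IsDualOptimal (N : CoopNetwork K) (lam mu : Fin 2 → ℝ) : Prop :=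
  (∀ i, 0 ≤ lam i) ∧ (∀ i, 0 ≤ mu i) ∧
    ∀ lam' mu' : Fin 2 → ℝ, (∀ i, 0 ≤ lam' i) → (∀ i, 0 ≤ mu' i) →
      N.dualFun lam' mu' ≤ N.dualFun lam mu

/-- Feasibility for the energy linear program with given powers `p`. -/
structure EnergyFeasible (N : CoopNetwork K) (p : ∀ i, K i → ℝ) (E G e : Fin 2 → ℝ) : Prop where
  balance : ∀ i, (∑ k, p i k) + N.Pc i = E i + G i + N.betaE * e (otherBS i) - e i
  E_nonneg : ∀ i, 0 ≤ E i
  E_le : ∀ i, E i ≤ N.Ebar i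
  G_nonneg : ∀ i, 0 ≤ G i
  e_nonneg : ∀ i, 0 ≤ e i

/-- `(E, G, e)` solves the energy linear program with given powers `p`. -/
def EnergyOptimal (N : CoopNetwork K) (p : ∀ i, K i → ℝ) (E G e : Fin 2 → ℝ) : Prop :=
  N.EnergyFeasible p E G e ∧
    ∀ E' G' e' : Fin 2 → ℝ, N.EnergyFeasible p E' G' e' → N.cost E G ≤ N.cost E' G'

/-- The water-filling bandwidth of terminal `k` of base station `i`. -/
def waterBand (N : CoopNetwork K) (lam mu : Fin 2 → ℝ) (i : Fin 2) (k : K i) : ℝ :=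
  Real.log 2 * N.r i k /
    (lambertW ((1 / Real.exp 1) * (lam i * N.g i k / (mu i * N.N0) - 1)) + 1)

/-- The power that meets the rate requirement of terminal `k` with equality at bandwidth `b`. -/
def ratePower (N : CoopNetwork K) (i : Fin 2) (k : K i) (b : ℝ) : ℝ :=
  b * N.N0 / N.g i k * ((2 : ℝ) ^ (N.r i k / b) - 1)

end CoopNetwork

end

/-!
The constraint on a single terminal, `r ≤ b log₂ (1 + g p / (b N₀))`, is an intersection of closed
half-planes, one for each tangent of the logarithm (`rate_iff_forall_tangent`); so the joint problem
is convex with a closed feasible set.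

An optimal solution exists by compactness (`CoopNetwork.exists_isOptimal`): the transfers are
unbounded when the efficiency is one, but cancelling opposite transfers at no cost makes them
one-way, after which every variable is bounded in terms of the cost. Serving every terminal with a
small bandwidth satisfies Slater's condition, so separating `(0, 0, optimal value)` from the set of
attainable excesses and costs yields multipliers without a duality gap
(`CoopNetwork.exists_multipliers`). Consequently every pair of a primal and a dual optimal solution
is a saddle point of the Lagrangian (`CoopNetwork.IsSaddle`).

At a saddle point the primal solution satisfies complementary slackness and minimizes the Lagrangian
in each variable separately. Minimizing over the purchases and transfers shows that free power means
no power demand, so `mu i > 0` wherever there are terminals. Minimizing over the bandwidth and power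
of one terminal is a one-variable problem whose stationarity condition is the equation defining
the Lambert function (`waterfilling_of_isMin`); it also forces `lam i > 0`, hence a tight band
constraint, from which the shared bandwidth is read off. As bandwidths and powers are thus unique,
what remains of the problem is the energy linear program, and the converse follows by comparison
with one optimal solution.
-/

/-! ### The Lambert function -/

theorem strictMonoOn_mul_exp : StrictMonoOn (fun w : ℝ => w * Real.exp w) (Set.Ici (-1)) := by
  apply strictMonoOn_of_deriv_pos (convex_Ici _)
  · fun_prop
  · intro w hw
    rw [interior_Ici, Set.mem_Ioi] at hw
    have h : HasDerivAt (fun w : ℝ => w * Real.exp w) (1 * Real.exp w + w * Real.exp w) w :=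
      (hasDerivAt_id w).mul (Real.hasDerivAt_exp w)
    rw [h.deriv]
    nlinarith [Real.exp_pos w]

theorem lambertW_mul_exp {w : ℝ} (hw : -1 ≤ w) : lambertW (w * Real.exp w) = w :=
  strictMonoOn_mul_exp.injOn.leftInvOn_invFunOn (Set.mem_Ici.2 hw)

/-! ### A single terminal -/

/-- The rate constraint is the intersection of the half-planes obtained by replacing the concave
function `x ↦ log (1 + x)` by its tangents. This makes the constraint visibly convex and closed,
including at zero bandwidth. -/
theorem rate_iff_forall_tangent {g N0 r b p : ℝ} (hg : 0 < g) (hN0 : 0 < N0) (hr : 0 < r)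
    (hb : 0 ≤ b) (hp : 0 ≤ p) :
    r ≤ b * Real.logb 2 (1 + g * p / (b * N0)) ↔
      ∀ s, 0 ≤ s →
        r * Real.log 2 ≤ b * (Real.log (1 + s) - s / (1 + s)) + g * p / N0 / (1 + s) := by
  have hl : 0 < Real.log 2 := Real.log_pos one_lt_two
  have hq : 0 ≤ g * p / N0 := by positivity
  have hdiv : g * p / (b * N0) = g * p / N0 / b := by rw [div_div, mul_comm b]
  rw [hdiv]
  set q := g * p / N0
  rcases hb.eq_or_lt with rfl | hb
  · constructor
    · intro h
      rw [zero_mul] at h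
      linarith
    · intro h
      -- At `s = q / (r log 2)` the right-hand side is `q r log 2 / (r log 2 + q) < r log 2`.
      have h1 := h (q / (r * Real.log 2)) (by positivity)
      have h2 : 0 < 1 + q / (r * Real.log 2) := by positivity
      rw [zero_mul, zero_add, le_div_iff₀ h2, mul_add, mul_div_cancel₀ _ (by positivity)] at h1
      nlinarith [mul_pos hr hl]
  · have hqb : 0 < 1 + q / b := by positivity
    have hiff : r ≤ b * Real.logb 2 (1 + q / b) ↔ r * Real.log 2 ≤ b * Real.log (1 + q / b) := by
      rw [Real.logb, ← mul_div_assoc, le_div_iff₀ hl]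
    rw [hiff]
    constructor
    · intro h s hs
      have hs' : 0 < 1 + s := by linarith
      have h1 := Real.log_le_sub_one_of_pos (div_pos hqb hs')
      rw [Real.log_div hqb.ne' hs'.ne'] at h1
      have h2 : b * Real.log (1 + q / b) ≤ b * (Real.log (1 + s) + ((1 + q / b) / (1 + s) - 1)) :=
        mul_le_mul_of_nonneg_left (by linarith) hb.le
      have h3 : b * (Real.log (1 + s) + ((1 + q / b) / (1 + s) - 1)) =
          b * (Real.log (1 + s) - s / (1 + s)) + q / (1 + s) := by
        field_simp
        ring
      linarith
    · intro h
      have h1 := h (q / b) (by positivity)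
      have h2 : b * (Real.log (1 + q / b) - q / b / (1 + q / b)) + q / (1 + q / b) =
          b * Real.log (1 + q / b) := by
        field_simp
        ring
      linarith

theorem band_pos_of_rate {g N0 r b p : ℝ} (hr : 0 < r) (hb : 0 ≤ b)
    (h : r ≤ b * Real.logb 2 (1 + g * p / (b * N0))) : 0 < b := by
  rcases hb.eq_or_lt with rfl | hb
  · rw [zero_mul] at h
    linarith
  · exact hb

theorem rate_of_power_eq {g N0 r b : ℝ} (hg : 0 < g) (hN0 : 0 < N0) (hb : 0 < b) :
    b * Real.logb 2 (1 + g * (b * N0 / g * ((2 : ℝ) ^ (r / b) - 1)) / (b * N0)) = r := by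
  have h : 1 + g * (b * N0 / g * ((2 : ℝ) ^ (r / b) - 1)) / (b * N0) = (2 : ℝ) ^ (r / b) := by
    field_simp
    ring
  rw [h, Real.logb_rpow (by norm_num) (by norm_num)]
  field_simp

theorem power_ge_of_rate {g N0 r b p : ℝ} (hg : 0 < g) (hN0 : 0 < N0) (hb : 0 < b) (hp : 0 ≤ p)
    (h : r ≤ b * Real.logb 2 (1 + g * p / (b * N0))) :
    b * N0 / g * ((2 : ℝ) ^ (r / b) - 1) ≤ p := by
  have h1 : r / b ≤ Real.logb 2 (1 + g * p / (b * N0)) := by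
    rwa [div_le_iff₀ hb, mul_comm]
  rw [Real.le_logb_iff_rpow_le one_lt_two (by positivity)] at h1
  calc b * N0 / g * ((2 : ℝ) ^ (r / b) - 1) ≤ b * N0 / g * (g * p / (b * N0)) := by
        apply mul_le_mul_of_nonneg_left _ (by positivity)
        linarith
    _ = p := by field_simp

theorem power_pos {g N0 r b : ℝ} (hg : 0 < g) (hN0 : 0 < N0) (hr : 0 < r) (hb : 0 < b) :
    0 < b * N0 / g * ((2 : ℝ) ^ (r / b) - 1) := by
  have : (1 : ℝ) < 2 ^ (r / b) := Real.one_lt_rpow one_lt_two (by positivity)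
  have : 0 < (2 : ℝ) ^ (r / b) - 1 := by linarith
  positivity

/-- Stationarity of `b ↦ l * b + m * p(b)`, with `p(b)` the least power that achieves the rate. In
the variable `u = r log 2 / b` it reads `(u - 1) * exp (u - 1) = (l g / (m N0) - 1) / e`, which
the Lambert function solves. -/
theorem waterfilling_of_isMin {g N0 r l m b p : ℝ} (hg : 0 < g) (hN0 : 0 < N0) (hr : 0 < r)
    (hm : 0 < m) (hb : 0 ≤ b) (hp : 0 ≤ p)
    (hrate : r ≤ b * Real.logb 2 (1 + g * p / (b * N0)))
    (hmin : ∀ b' p', 0 ≤ b' → 0 ≤ p' → r ≤ b' * Real.logb 2 (1 + g * p' / (b' * N0)) →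
      l * b + m * p ≤ l * b' + m * p') :
    0 < l ∧
      b = Real.log 2 * r / (lambertW ((1 / Real.exp 1) * (l * g / (m * N0) - 1)) + 1) ∧
      p = b * N0 / g * ((2 : ℝ) ^ (r / b) - 1) := by
  have hl2 : 0 < Real.log 2 := Real.log_pos one_lt_two
  have hb : 0 < b := band_pos_of_rate hr hb hrate
  have hval : ∀ b', 0 < b' →
      l * b + m * p ≤ l * b' + m * (b' * N0 / g * ((2 : ℝ) ^ (r / b') - 1)) := fun b' hb' =>
    hmin b' _ hb'.le (power_pos hg hN0 hr hb').le (rate_of_power_eq hg hN0 hb').ge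
  have hpeq : p = b * N0 / g * ((2 : ℝ) ^ (r / b) - 1) := by
    apply le_antisymm _ (power_ge_of_rate hg hN0 hb hp hrate)
    have := hval b hb
    exact le_of_mul_le_mul_left (by linarith) hm
  obtain ⟨u, hu⟩ : ∃ u, u = Real.log 2 * (r / b) := ⟨_, rfl⟩
  have hupos : 0 < u := by rw [hu]; positivity
  have hrpow : ∀ t : ℝ, (2 : ℝ) ^ t = Real.exp (Real.log 2 * t) := fun t =>
    Real.rpow_def_of_pos two_pos t
  have hderiv : HasDerivAt
      (fun t => l * t + m * (t * N0 / g * (Real.exp (Real.log 2 * (r / t)) - 1)))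
      (l + m * (N0 / g) * (Real.exp u * (1 - u) - 1)) b := by
    have h1 : HasDerivAt (fun t => Real.log 2 * (r / t)) (Real.log 2 * (r * (-(b ^ 2)⁻¹))) b :=
      ((hasDerivAt_inv hb.ne').const_mul r).const_mul (Real.log 2)
    have h2 := (h1.exp.sub_const 1)
    have h3 : HasDerivAt (fun t : ℝ => t * N0 / g) (1 * N0 / g) b :=
      ((hasDerivAt_id b).mul_const N0).div_const g
    have h4 := ((hasDerivAt_id b).const_mul l).add ((h3.mul h2).const_mul m)
    refine h4.congr_deriv ?_
    rw [hu]
    field_simp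
    ring
  have hloc : IsLocalMin
      (fun t => l * t + m * (t * N0 / g * (Real.exp (Real.log 2 * (r / t)) - 1))) b := by
    filter_upwards [Ioi_mem_nhds hb] with t ht
    have := hval t ht
    rw [hpeq] at this
    simpa only [hrpow] using this
  have hzero := hloc.hasDerivAt_eq_zero hderiv
  have hstat : l * g / (m * N0) - 1 = (u - 1) * Real.exp u := by
    have : l = m * (N0 / g) * ((u - 1) * Real.exp u + 1) := by linarith
    rw [this]
    field_simp
    ring
  refine ⟨?_, ?_, hpeq⟩
  · have h1 : -u < Real.exp (-u) - 1 := by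
      have := Real.add_one_lt_exp (x := -u) (by linarith)
      linarith
    have h2 : 0 < (u - 1) * Real.exp u + 1 := by
      have h3 : Real.exp (-u) * Real.exp u = 1 := by rw [← Real.exp_add]; simp
      nlinarith [Real.exp_pos u]
    have h4 : 0 < l * g / (m * N0) := by linarith
    have h5 : l * g / (m * N0) = l * (g / (m * N0)) := by ring
    rw [h5] at h4
    exact pos_of_mul_pos_left h4 (by positivity)
  · have harg : (1 / Real.exp 1) * (l * g / (m * N0) - 1) = (u - 1) * Real.exp (u - 1) := by
      rw [hstat, Real.exp_sub]
      ring
    rw [harg, lambertW_mul_exp (by linarith), sub_add_cancel, hu]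
    field_simp

namespace CoopNetwork

variable {K : Fin 2 → Type*}

/-! ### Convexity, cost bounds and Slater's condition -/

/-- The combination `s x + t y` of two decisions, taken componentwise. -/
def combo (s t : ℝ) (x y : CoopDecision K) : CoopDecision K where
  E i := s * x.E i + t * y.E i
  G i := s * x.G i + t * y.G i
  e i := s * x.e i + t * y.e i
  w i := s * x.w i + t * y.w i
  b i k := s * x.b i k + t * y.b i k
  p i k := s * x.p i k + t * y.p i k

theorem cost_combo (N : CoopNetwork K) (s t : ℝ) (x y : CoopDecision K) :
    N.cost (combo s t x y).E (combo s t x y).G = s * N.cost x.E x.G + t * N.cost y.E y.G := by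
  simp only [cost, combo, Fin.sum_univ_two]
  ring

theorem InDomain.combo {N : CoopNetwork K} (hN0 : 0 < N.N0) (hg : ∀ i k, 0 < N.g i k)
    (hr : ∀ i k, 0 < N.r i k) {s t : ℝ} (hs : 0 ≤ s) (ht : 0 ≤ t) (hst : s + t = 1)
    {x y : CoopDecision K} (hx : N.InDomain x) (hy : N.InDomain y) :
    N.InDomain (combo s t x y) := by
  have nn : ∀ {a c : ℝ}, 0 ≤ a → 0 ≤ c → 0 ≤ s * a + t * c := fun ha hc =>
    add_nonneg (mul_nonneg hs ha) (mul_nonneg ht hc)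
  refine ⟨fun i => nn (hx.E_nonneg i) (hy.E_nonneg i), fun i => nn (hx.G_nonneg i) (hy.G_nonneg i),
    fun i => nn (hx.e_nonneg i) (hy.e_nonneg i), fun i => nn (hx.w_nonneg i) (hy.w_nonneg i),
    fun i k => nn (hx.b_nonneg i k) (hy.b_nonneg i k),
    fun i k => nn (hx.p_nonneg i k) (hy.p_nonneg i k), fun i => ?_, fun i k => ?_⟩
  · calc s * x.E i + t * y.E i ≤ s * N.Ebar i + t * N.Ebar i :=
          add_le_add (mul_le_mul_of_nonneg_left (hx.E_le i) hs)
            (mul_le_mul_of_nonneg_left (hy.E_le i) ht)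
      _ = N.Ebar i := by rw [← add_mul, hst, one_mul]
  · refine (rate_iff_forall_tangent (hg i k) hN0 (hr i k)
      (nn (hx.b_nonneg i k) (hy.b_nonneg i k)) (nn (hx.p_nonneg i k) (hy.p_nonneg i k))).2
      fun a ha => ?_
    have h1 := (rate_iff_forall_tangent (hg i k) hN0 (hr i k) (hx.b_nonneg i k)
      (hx.p_nonneg i k)).1 (hx.rate i k) a ha
    have h2 := (rate_iff_forall_tangent (hg i k) hN0 (hr i k) (hy.b_nonneg i k)
      (hy.p_nonneg i k)).1 (hy.rate i k) a ha
    have h3 := add_le_add (mul_le_mul_of_nonneg_left h1 hs) (mul_le_mul_of_nonneg_left h2 ht)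
    rw [← add_mul, hst, one_mul] at h3
    refine h3.trans (le_of_eq ?_)
    ring

theorem grid_cost_le_cost {N : CoopNetwork K} (halphaE : ∀ i, 0 < N.alphaE i)
    (halphaG : ∀ i, 0 < N.alphaG i) (hgam : ∀ i, 0 < N.gam i) {E G : Fin 2 → ℝ}
    (hE : ∀ i, 0 ≤ E i) (hG : ∀ i, 0 ≤ G i) (i : Fin 2) :
    N.gam i * (N.alphaG i * G i) ≤ N.cost E G := by
  have h : ∀ j, 0 ≤ N.gam j * (N.alphaE j * E j + N.alphaG j * G j) := fun j =>
    mul_nonneg (hgam j).le (add_nonneg (mul_nonneg (halphaE j).le (hE j))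
      (mul_nonneg (halphaG j).le (hG j)))
  calc N.gam i * (N.alphaG i * G i) ≤ N.gam i * (N.alphaE i * E i + N.alphaG i * G i) :=
        mul_le_mul_of_nonneg_left (by linarith [mul_nonneg (halphaE i).le (hE i)]) (hgam i).le
    _ ≤ N.cost E G := Finset.single_le_sum (f := fun j =>
        N.gam j * (N.alphaE j * E j + N.alphaG j * G j)) (fun j _ => h j) (Finset.mem_univ i)

variable [∀ i, Fintype (K i)]

theorem powerExcess_combo (N : CoopNetwork K) {s t : ℝ} (hst : s + t = 1) (x y : CoopDecision K)
    (i : Fin 2) :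
    N.powerExcess (combo s t x y) i = s * N.powerExcess x i + t * N.powerExcess y i := by
  simp only [powerExcess, combo, Finset.sum_add_distrib, ← Finset.mul_sum]
  linear_combination (-N.Pc i) * hst

theorem bandExcess_combo (N : CoopNetwork K) {s t : ℝ} (hst : s + t = 1) (x y : CoopDecision K)
    (i : Fin 2) :
    N.bandExcess (combo s t x y) i = s * N.bandExcess x i + t * N.bandExcess y i := by
  simp only [bandExcess, combo, Finset.sum_add_distrib, ← Finset.mul_sum]
  linear_combination (N.W i) * hst

theorem exists_slater (N : CoopNetwork K) (hW : ∀ i, 0 < N.W i) (hEbar : ∀ i, 0 ≤ N.Ebar i)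
    (hPc : ∀ i, 0 ≤ N.Pc i) (hN0 : 0 < N.N0) (hg : ∀ i k, 0 < N.g i k)
    (hr : ∀ i k, 0 < N.r i k) :
    ∃ x, N.InDomain x ∧ (∀ i, N.powerExcess x i < 0) ∧ ∀ i, N.bandExcess x i < 0 := by
  obtain ⟨b, hb⟩ : ∃ b : Fin 2 → ℝ, ∀ i, b i = N.W i / (Fintype.card (K i) + 1) := ⟨_, fun _ => rfl⟩
  have hbpos : ∀ i, 0 < b i := fun i => by
    rw [hb]
    exact div_pos (hW i) (by positivity)
  have hp : ∀ i k, 0 < N.ratePower i k (b i) := fun i k => power_pos (hg i k) hN0 (hr i k) (hbpos i)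
  refine ⟨⟨0, fun i => (∑ k, N.ratePower i k (b i)) + N.Pc i + 1, 0, 0, fun i _ => b i,
    fun i k => N.ratePower i k (b i)⟩, ⟨fun _ => le_rfl, fun i => ?_, fun _ => le_rfl,
    fun _ => le_rfl, fun i _ => (hbpos i).le, fun i k => (hp i k).le, hEbar, fun i k => ?_⟩,
    fun i => ?_, fun i => ?_⟩
  · have := Finset.sum_nonneg fun k (_ : k ∈ Finset.univ) => (hp i k).le
    have := hPc i
    positivity
  · exact (rate_of_power_eq (hg i k) hN0 (hbpos i)).ge
  · simp [powerExcess]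
  · have h : (Fintype.card (K i) + 1) * b i = N.W i := by
      rw [hb]
      field_simp
    simp only [bandExcess, Finset.sum_const, Finset.card_univ, nsmul_eq_mul, Pi.zero_apply,
      mul_zero, add_zero, sub_zero]
    linarith [hbpos i]

/-! ### Existence of an optimal solution -/

theorem otherBS_zero : otherBS 0 = 1 := rfl

theorem otherBS_one : otherBS 1 = 0 := rfl

/-- Subtracting the common part of the two transfers, of energy and of bandwidth, keeps a decision
feasible and leaves at most one direction of transfer active. -/
theorem IsFeasible.exists_one_way {N : CoopNetwork K} (hbetaE1 : N.betaE ≤ 1)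
    (hbetaB1 : N.betaB ≤ 1) {x : CoopDecision K} (hx : N.IsFeasible x) :
    ∃ y, N.IsFeasible y ∧ y.E = x.E ∧ y.G = x.G ∧ y.e 0 * y.e 1 = 0 ∧ y.w 0 * y.w 1 = 0 := by
  have hsub : ∀ a : Fin 2 → ℝ, (∀ i, 0 ≤ a i) → ∃ m, 0 ≤ m ∧ (∀ i, 0 ≤ a i - m) ∧
      (a 0 - m) * (a 1 - m) = 0 := by
    intro a ha
    rcases le_total (a 0) (a 1) with h | h
    · exact ⟨a 0, ha 0, Fin.forall_fin_two.2 ⟨by simp, by linarith⟩, by simp⟩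
    · exact ⟨a 1, ha 1, Fin.forall_fin_two.2 ⟨by linarith, by simp⟩, by simp⟩
  obtain ⟨m, hm, hm1, hm2⟩ := hsub x.e hx.inDomain.e_nonneg
  obtain ⟨n, hn, hn1, hn2⟩ := hsub x.w hx.inDomain.w_nonneg
  refine ⟨⟨x.E, x.G, fun i => x.e i - m, fun i => x.w i - n, x.b, x.p⟩,
    ⟨{ hx.inDomain with e_nonneg := hm1, w_nonneg := hn1 }, fun i => ?_, fun i => ?_⟩,
    rfl, rfl, hm2, hn2⟩
  · have := hx.power i
    simp only [powerExcess] at this ⊢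
    nlinarith
  · have := hx.band i
    simp only [bandExcess] at this ⊢
    nlinarith

/-- The tuple of components of a decision; its type carries the product topology. -/
abbrev DecisionTuple (K : Fin 2 → Type*) : Type _ :=
  (Fin 2 → ℝ) × (Fin 2 → ℝ) × (Fin 2 → ℝ) × (Fin 2 → ℝ) × (∀ i, K i → ℝ) × (∀ i, K i → ℝ)

/-- The decision with the given components. -/
def ofTuple (z : DecisionTuple K) : CoopDecision K :=
  ⟨z.1, z.2.1, z.2.2.1, z.2.2.2.1, z.2.2.2.2.1, z.2.2.2.2.2⟩

theorem isClosed_setOf_isFeasible (N : CoopNetwork K) (hN0 : 0 < N.N0) (hg : ∀ i k, 0 < N.g i k)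
    (hr : ∀ i k, 0 < N.r i k) : IsClosed {z : DecisionTuple K | N.IsFeasible (ofTuple z)} := by
  have h : {z : DecisionTuple K | N.IsFeasible (ofTuple z)} =
      {z | (∀ i, 0 ≤ z.1 i) ∧ (∀ i, 0 ≤ z.2.1 i) ∧ (∀ i, 0 ≤ z.2.2.1 i) ∧
        (∀ i, 0 ≤ z.2.2.2.1 i) ∧ (∀ i k, 0 ≤ z.2.2.2.2.1 i k) ∧ (∀ i k, 0 ≤ z.2.2.2.2.2 i k) ∧
        (∀ i, z.1 i ≤ N.Ebar i) ∧
        (∀ i k s, 0 ≤ s → N.r i k * Real.log 2 ≤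
          z.2.2.2.2.1 i k * (Real.log (1 + s) - s / (1 + s)) +
            N.g i k * z.2.2.2.2.2 i k / N.N0 / (1 + s)) ∧
        (∀ i, N.powerExcess (ofTuple z) i ≤ 0) ∧ ∀ i, N.bandExcess (ofTuple z) i ≤ 0} := by
    ext z
    constructor
    · intro h
      exact ⟨h.inDomain.E_nonneg, h.inDomain.G_nonneg, h.inDomain.e_nonneg, h.inDomain.w_nonneg,
        h.inDomain.b_nonneg, h.inDomain.p_nonneg, h.inDomain.E_le,
        fun i k => (rate_iff_forall_tangent (hg i k) hN0 (hr i k) (h.inDomain.b_nonneg i k)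
          (h.inDomain.p_nonneg i k)).1 (h.inDomain.rate i k), h.power, h.band⟩
    · rintro ⟨h1, h2, h3, h4, h5, h6, h7, h8, h9, h10⟩
      exact ⟨⟨h1, h2, h3, h4, h5, h6, h7, fun i k => (rate_iff_forall_tangent (hg i k) hN0
        (hr i k) (h5 i k) (h6 i k)).2 (h8 i k)⟩, h9, h10⟩
  rw [h]
  simp only [powerExcess, bandExcess, ofTuple, Set.ofPred_and, Set.ofPred_forall]
  repeat' first
    | apply IsClosed.inter
    | refine isClosed_iInter fun _ => ?_
    | exact isClosed_le (by fun_prop) (by fun_prop)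

/-- If at most one of two transfers `a 0`, `a 1` is nonzero, then the balance of supply `c i` and
nonnegative demand `d i` at both stations bounds the transfers and the demand. -/
theorem bounds_of_one_way {β M : ℝ} (hβ1 : β ≤ 1) {a c d : Fin 2 → ℝ}
    (ha : ∀ i, 0 ≤ a i) (hd : ∀ i, 0 ≤ d i) (hc : ∀ i, c i ≤ M) (hc0 : 0 ≤ M)
    (h : ∀ i, d i ≤ c i + β * a (otherBS i) - a i)
    (hprod : a 0 * a 1 = 0) (i : Fin 2) : a i ≤ M ∧ d i ≤ 2 * M := by
  have h0 := h 0
  have h1 := h 1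
  rw [otherBS_zero] at h0
  rw [otherBS_one] at h1
  have := hd 0; have := hd 1; have := hc 0; have := hc 1; have := ha 0; have := ha 1
  have hle : ∀ j, a j ≤ M := by
    rcases mul_eq_zero.1 hprod with hz | hz <;> simp only [hz, mul_zero] at h0 h1 <;>
      refine Fin.forall_fin_two.2 ⟨?_, ?_⟩ <;> linarith
  refine ⟨hle i, ?_⟩
  have h2 : ∀ j, β * a j ≤ M := fun j =>
    (mul_le_of_le_one_left (ha j) hβ1).trans (hle j)
  linarith [h i, h2 (otherBS i), ha i, hc i]

theorem exists_isOptimal (N : CoopNetwork K) (hPc : ∀ i, 0 ≤ N.Pc i)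
    (halphaE : ∀ i, 0 < N.alphaE i) (halphaG : ∀ i, 0 < N.alphaG i) (hgam : ∀ i, 0 < N.gam i)
    (hbetaE1 : N.betaE ≤ 1) (hbetaB1 : N.betaB ≤ 1) (hN0 : 0 < N.N0) (hg : ∀ i k, 0 < N.g i k)
    (hr : ∀ i k, 0 < N.r i k) {x₀ : CoopDecision K} (hx₀ : N.IsFeasible x₀) :
    ∃ x, N.IsOptimal x := by
  obtain ⟨C, hC⟩ : ∃ C, C = N.cost x₀.E x₀.G := ⟨_, rfl⟩
  set S : Set (DecisionTuple K) := {z | N.IsFeasible (ofTuple z)} ∩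
    ({z | N.cost z.1 z.2.1 ≤ C} ∩ ({z | z.2.2.1 0 * z.2.2.1 1 = 0} ∩
      {z | z.2.2.2.1 0 * z.2.2.2.1 1 = 0}))
  have hmem : ∀ x, N.IsFeasible x → N.cost x.E x.G ≤ C →
      ∃ z ∈ S, N.cost z.1 z.2.1 = N.cost x.E x.G := by
    intro x hx hxC
    obtain ⟨y, hy, hyE, hyG, hye, hyw⟩ := hx.exists_one_way hbetaE1 hbetaB1
    refine ⟨(y.E, y.G, y.e, y.w, y.b, y.p), ⟨hy, ?_, hye, hyw⟩, by simp only [hyE, hyG]⟩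
    simpa only [Set.mem_ofPred_eq, hyE, hyG] using hxC
  have hcont : Continuous fun z : DecisionTuple K => N.cost z.1 z.2.1 := by
    unfold cost
    fun_prop
  have hclosed : IsClosed S := (N.isClosed_setOf_isFeasible hN0 hg hr).inter
    ((isClosed_le hcont continuous_const).inter ((isClosed_eq (by fun_prop) continuous_const).inter
      (isClosed_eq (by fun_prop) continuous_const)))
  obtain ⟨A, hA⟩ : ∃ A : Fin 2 → ℝ, ∀ i, A i = C / (N.gam i * N.alphaG i) := ⟨_, fun _ => rfl⟩
  have hbound : ∃ B : ℝ, ∀ z ∈ S, (∀ i, z.1 i ≤ B) ∧ (∀ i, z.2.1 i ≤ B) ∧ (∀ i, z.2.2.1 i ≤ B) ∧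
      (∀ i, z.2.2.2.1 i ≤ B) ∧ (∀ i k, z.2.2.2.2.1 i k ≤ B) ∧ (∀ i k, z.2.2.2.2.2 i k ≤ B) := by
    obtain ⟨M, hM⟩ : ∃ M, M = ∑ i, (|N.Ebar i| + |A i| + |N.W i|) := ⟨_, rfl⟩
    have hle : ∀ i, |N.Ebar i| + |A i| + |N.W i| ≤ M := fun i => by
      rw [hM]
      exact Finset.single_le_sum (f := fun i => |N.Ebar i| + |A i| + |N.W i|)
        (fun j _ => by positivity) (Finset.mem_univ i)
    refine ⟨2 * M, fun z hz => ?_⟩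
    obtain ⟨hf, hzC, hze, hzw⟩ := hz
    have hGA : ∀ i, z.2.1 i ≤ |A i| := fun i => by
      refine le_trans ?_ (le_abs_self _)
      rw [hA, le_div_iff₀ (mul_pos (hgam i) (halphaG i))]
      have := grid_cost_le_cost halphaE halphaG hgam hf.inDomain.E_nonneg hf.inDomain.G_nonneg i
      simp only [ofTuple] at this
      have hzC' : N.cost z.1 z.2.1 ≤ C := hzC
      linarith
    have hEA : ∀ i, z.1 i ≤ |N.Ebar i| := fun i => (hf.inDomain.E_le i).trans (le_abs_self _)
    have hWA : ∀ i, N.W i ≤ |N.W i| := fun i => le_abs_self _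
    have hM0 : 0 ≤ M := by rw [hM]; positivity
    have hpw := bounds_of_one_way (M := M) (c := fun i => z.1 i + z.2.1 i)
      (d := fun i => ∑ k, z.2.2.2.2.2 i k) hbetaE1 hf.inDomain.e_nonneg
      (fun i => Finset.sum_nonneg fun k _ => hf.inDomain.p_nonneg i k)
      (fun i => by linarith [hle i, hGA i, hEA i, abs_nonneg (N.W i)]) hM0
      (fun i => by
        have := hf.power i
        have := hPc i
        simp only [powerExcess, ofTuple] at *
        linarith) hze
    have hbw := bounds_of_one_way (M := M) (c := N.W)
      (d := fun i => ∑ k, z.2.2.2.2.1 i k) hbetaB1 hf.inDomain.w_nonneg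
      (fun i => Finset.sum_nonneg fun k _ => hf.inDomain.b_nonneg i k)
      (fun i => by linarith [hle i, hWA i, abs_nonneg (N.Ebar i), abs_nonneg (A i)]) hM0
      (fun i => by
        have := hf.band i
        simp only [bandExcess, ofTuple] at *
        linarith) hzw
    have habs : ∀ i, 0 ≤ |N.Ebar i| ∧ 0 ≤ |A i| ∧ 0 ≤ |N.W i| := fun i =>
      ⟨abs_nonneg _, abs_nonneg _, abs_nonneg _⟩
    refine ⟨fun i => ?_, fun i => ?_, fun i => ?_, fun i => ?_, fun i k => ?_, fun i k => ?_⟩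
    · linarith [hEA i, hle i, habs i]
    · linarith [hGA i, hle i, habs i]
    · exact (hpw i).1.trans (by linarith)
    · exact (hbw i).1.trans (by linarith)
    · exact (Finset.single_le_sum (f := fun k => z.2.2.2.2.1 i k)
        (fun k _ => hf.inDomain.b_nonneg i k) (Finset.mem_univ k)).trans (hbw i).2
    · exact (Finset.single_le_sum (f := fun k => z.2.2.2.2.2 i k)
        (fun k _ => hf.inDomain.p_nonneg i k) (Finset.mem_univ k)).trans (hpw i).2
  obtain ⟨B, hB⟩ := hbound
  have hcompact : IsCompact S := by
    refine IsCompact.of_isClosed_subset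
      (isCompact_Icc (a := (0 : DecisionTuple K))
        (b := (fun _ => B, fun _ => B, fun _ => B, fun _ => B, fun _ _ => B, fun _ _ => B)))
      hclosed fun z hz => ?_
    obtain ⟨h1, h2, h3, h4, h5, h6⟩ := hB z hz
    have hd := hz.1.inDomain
    exact ⟨⟨hd.E_nonneg, hd.G_nonneg, hd.e_nonneg, hd.w_nonneg, hd.b_nonneg, hd.p_nonneg⟩,
      ⟨h1, h2, h3, h4, h5, h6⟩⟩
  obtain ⟨z₀, hz₀, -⟩ := hmem x₀ hx₀ hC.ge
  obtain ⟨z, hz, hzmin⟩ := hcompact.exists_isMinOn ⟨z₀, hz₀⟩ hcont.continuousOn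
  refine ⟨ofTuple z, hz.1, fun y hy => ?_⟩
  rcases le_total (N.cost y.E y.G) C with h | h
  · obtain ⟨z', hz', hcost⟩ := hmem y hy h
    rw [← hcost]
    exact hzmin hz'
  · exact (show N.cost z.1 z.2.1 ≤ C from hz.2.1).trans h

/-! ### Strong duality -/

theorem nonpos_of_forall_add_mul_lt {a c M : ℝ} (h : ∀ s, 0 ≤ s → a + s * c < M) : c ≤ 0 := by
  by_contra! hc
  have h0 := h 0 le_rfl
  have h1 := h ((M - a) / c) (div_nonneg (by linarith) hc.le)
  rw [div_mul_cancel₀ _ hc.ne'] at h1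
  linarith

/-- Strong duality. The open convex set of all triples exceeding, in every coordinate, the power
excess, the band excess and the cost of some decision of the domain does not contain `(0, 0, v)`,
with `v` the optimal value, and a separating hyperplane is not vertical by Slater's condition. -/
theorem exists_multipliers (N : CoopNetwork K) (hN0 : 0 < N.N0) (hg : ∀ i k, 0 < N.g i k)
    (hr : ∀ i k, 0 < N.r i k)
    (hslater : ∃ x, N.InDomain x ∧ (∀ i, N.powerExcess x i < 0) ∧ ∀ i, N.bandExcess x i < 0)
    {x : CoopDecision K} (hx : N.IsOptimal x) :
    ∃ lam mu : Fin 2 → ℝ, (∀ i, 0 ≤ lam i) ∧ (∀ i, 0 ≤ mu i) ∧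
      ∀ y, N.InDomain y → N.cost x.E x.G ≤ N.lagrangian lam mu y := by
  set v := N.cost x.E x.G
  set A : Set ((Fin 2 → ℝ) × (Fin 2 → ℝ) × ℝ) := {z | ∃ y, N.InDomain y ∧
    (∀ i, N.powerExcess y i < z.1 i) ∧ (∀ i, N.bandExcess y i < z.2.1 i) ∧
      N.cost y.E y.G < z.2.2} with hA
  have hconv : Convex ℝ A := by
    rintro z₁ ⟨y₁, hd₁, hp₁, hb₁, hc₁⟩ z₂ ⟨y₂, hd₂, hp₂, hb₂, hc₂⟩ s t hs ht hst
    have key : ∀ {a b c d : ℝ}, a < c → b < d → s * a + t * b < s * c + t * d := by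
      intro a b c d h1 h2
      rcases hs.eq_or_lt with rfl | hs
      · rw [zero_add] at hst
        subst hst
        linarith
      · exact add_lt_add_of_lt_of_le (mul_lt_mul_of_pos_left h1 hs)
          (mul_le_mul_of_nonneg_left h2.le ht)
    refine ⟨combo s t y₁ y₂, hd₁.combo hN0 hg hr hs ht hst hd₂, fun i => ?_, fun i => ?_, ?_⟩
    · rw [powerExcess_combo N hst]
      exact key (hp₁ i) (hp₂ i)
    · rw [bandExcess_combo N hst]
      exact key (hb₁ i) (hb₂ i)
    · rw [cost_combo]
      exact key hc₁ hc₂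
  have hopen : IsOpen A := by
    have : A = ⋃ y : {y // N.InDomain y}, (⋂ i, {z | N.powerExcess y.1 i < z.1 i}) ∩
        ((⋂ i, {z | N.bandExcess y.1 i < z.2.1 i}) ∩ {z | N.cost y.1.E y.1.G < z.2.2}) := by
      ext z
      simp only [hA, Set.mem_ofPred_eq, Set.mem_iUnion, Set.mem_inter_iff, Set.mem_iInter,
        Subtype.exists, exists_prop]
    rw [this]
    refine isOpen_iUnion fun y => IsOpen.inter ?_ (IsOpen.inter ?_ ?_)
    · exact isOpen_iInter_of_finite fun i => isOpen_lt continuous_const (by fun_prop)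
    · exact isOpen_iInter_of_finite fun i => isOpen_lt continuous_const (by fun_prop)
    · exact isOpen_lt continuous_const (by fun_prop)
  have hnot : ((0, 0, v) : (Fin 2 → ℝ) × (Fin 2 → ℝ) × ℝ) ∉ A := by
    rintro ⟨y, hd, hp, hb, hc⟩
    exact (hx.2 y ⟨hd, fun i => (hp i).le, fun i => (hb i).le⟩).not_gt hc
  obtain ⟨f, hf⟩ := geometric_hahn_banach_open_point hconv hopen hnot
  obtain ⟨P, hP⟩ : ∃ P : Fin 2 → ℝ, ∀ i, P i = f (Pi.single i 1, 0, 0) := ⟨_, fun _ => rfl⟩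
  obtain ⟨Q, hQ⟩ : ∃ Q : Fin 2 → ℝ, ∀ i, Q i = f (0, Pi.single i 1, 0) := ⟨_, fun _ => rfl⟩
  obtain ⟨D, hD⟩ : ∃ D, D = f (0, 0, 1) := ⟨_, rfl⟩
  have hfeq : ∀ a b c, f (a, b, c) = (∑ i, a i * P i) + (∑ i, b i * Q i) + c * D := by
    intro a b c
    have : (a, b, c) = (∑ i, a i • ((Pi.single i 1, 0, 0) : (Fin 2 → ℝ) × (Fin 2 → ℝ) × ℝ)) +
        (∑ i, b i • ((0, Pi.single i 1, 0) : (Fin 2 → ℝ) × (Fin 2 → ℝ) × ℝ)) +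
          c • ((0, 0, 1) : (Fin 2 → ℝ) × (Fin 2 → ℝ) × ℝ) := by
      refine Prod.ext ?_ (Prod.ext ?_ ?_)
      · ext i
        fin_cases i <;> simp [Fin.sum_univ_two]
      · ext i
        fin_cases i <;> simp [Fin.sum_univ_two]
      · simp [Fin.sum_univ_two]
    rw [this, map_add, map_add, map_sum, map_sum]
    simp only [map_smul, smul_eq_mul, hP, hQ, hD]
  have hlt : ∀ y, N.InDomain y → ∀ a b : Fin 2 → ℝ, ∀ c : ℝ, (∀ i, 0 < a i) → (∀ i, 0 < b i) →
      0 < c → (∑ i, (N.powerExcess y i + a i) * P i) + (∑ i, (N.bandExcess y i + b i) * Q i) +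
        (N.cost y.E y.G + c) * D < v * D := by
    intro y hy a b c ha hb hc
    have h := hf (fun i => N.powerExcess y i + a i, fun i => N.bandExcess y i + b i,
      N.cost y.E y.G + c) ⟨y, hy, fun i => by linarith [ha i], fun i => by linarith [hb i],
        by linarith⟩
    rw [hfeq, hfeq] at h
    simpa using h
  obtain ⟨y₀, hy₀, hp₀, hb₀⟩ := hslater
  have hone : ∀ i : Fin 2, (0 : ℝ) < (fun _ => 1 : Fin 2 → ℝ) i := fun _ => one_pos
  have hpos : ∀ (j : Fin 2) {s : ℝ}, 0 ≤ s → ∀ i, 0 < 1 + s * (Pi.single j 1 : Fin 2 → ℝ) i := by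
    intro j s hs i
    have : (0 : ℝ) ≤ (Pi.single j 1 : Fin 2 → ℝ) i := by
      by_cases h : i = j
      · subst h; simp
      · simp [h]
    positivity
  have hsingle : ∀ (j : Fin 2) (u R : Fin 2 → ℝ) (s : ℝ),
      ∑ i, (u i + (1 + s * (Pi.single j 1 : Fin 2 → ℝ) i)) * R i =
        (∑ i, (u i + 1) * R i) + s * R j := by
    intro j u R s
    fin_cases j <;> simp [Fin.sum_univ_two] <;> ring
  have hPle : ∀ j, P j ≤ 0 := fun j => by
    refine nonpos_of_forall_add_mul_lt (M := v * D)
      (a := (∑ i, (N.powerExcess y₀ i + 1) * P i) + (∑ i, (N.bandExcess y₀ i + 1) * Q i) +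
        (N.cost y₀.E y₀.G + 1) * D) fun s hs => ?_
    have := hlt y₀ hy₀ _ _ 1 (hpos j hs) hone one_pos
    rw [hsingle] at this
    linarith
  have hQle : ∀ j, Q j ≤ 0 := fun j => by
    refine nonpos_of_forall_add_mul_lt (M := v * D)
      (a := (∑ i, (N.powerExcess y₀ i + 1) * P i) + (∑ i, (N.bandExcess y₀ i + 1) * Q i) +
        (N.cost y₀.E y₀.G + 1) * D) fun s hs => ?_
    have := hlt y₀ hy₀ _ _ 1 hone (hpos j hs) one_pos
    rw [hsingle] at this
    linarith
  have hDle : D ≤ 0 := by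
    refine nonpos_of_forall_add_mul_lt (M := v * D)
      (a := (∑ i, (N.powerExcess y₀ i + 1) * P i) + (∑ i, (N.bandExcess y₀ i + 1) * Q i) +
        (N.cost y₀.E y₀.G + 1) * D) fun s hs => ?_
    have := hlt y₀ hy₀ _ _ (1 + s) hone hone (by linarith)
    linarith
  have hDneg : D < 0 := by
    refine hDle.lt_of_ne fun hD0 => ?_
    -- The point `(0, 0, c)` lies in `A` for large `c` by Slater's condition.
    have := hlt y₀ hy₀ (fun i => -N.powerExcess y₀ i) (fun i => -N.bandExcess y₀ i) 1
      (fun i => by linarith [hp₀ i]) (fun i => by linarith [hb₀ i]) one_pos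
    simp [hD0] at this
  have hle : ∀ y, N.InDomain y → (∑ i, N.powerExcess y i * P i) +
      (∑ i, N.bandExcess y i * Q i) + N.cost y.E y.G * D ≤ v * D := by
    intro y hy
    refine ge_of_tendsto (f := fun ε : ℝ => v * D - ε * ((∑ i, P i) + (∑ i, Q i) + D))
      (x := nhdsWithin 0 (Set.Ioi 0)) ?_ ?_
    · have : Filter.Tendsto (fun ε : ℝ => v * D - ε * ((∑ i, P i) + (∑ i, Q i) + D)) (nhds 0)
          (nhds (v * D - 0 * ((∑ i, P i) + (∑ i, Q i) + D))) :=
        Continuous.tendsto (by fun_prop) 0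
      rw [zero_mul, sub_zero] at this
      exact this.mono_left nhdsWithin_le_nhds
    · filter_upwards [self_mem_nhdsWithin] with ε hε
      have := hlt y hy (fun _ => ε) (fun _ => ε) ε (fun _ => hε) (fun _ => hε) hε
      simp only [add_mul, Finset.sum_add_distrib, ← Finset.mul_sum] at this
      linarith
  refine ⟨fun i => Q i / D, fun i => P i / D, fun i => div_nonneg_of_nonpos (hQle i) hDle,
    fun i => div_nonneg_of_nonpos (hPle i) hDle, fun y hy => ?_⟩
  have h : N.lagrangian (fun i => Q i / D) (fun i => P i / D) y * D =
      (∑ i, N.powerExcess y i * P i) + (∑ i, N.bandExcess y i * Q i) + N.cost y.E y.G * D := by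
    have hD' := hDneg.ne
    simp only [lagrangian, Fin.sum_univ_two]
    field_simp
    ring
  exact (mul_le_mul_right_of_neg hDneg).1 (h ▸ hle y hy)

theorem lagrangian_le_cost (N : CoopNetwork K) {lam mu : Fin 2 → ℝ} (hlam : ∀ i, 0 ≤ lam i)
    (hmu : ∀ i, 0 ≤ mu i) {x : CoopDecision K} (hx : N.IsFeasible x) :
    N.lagrangian lam mu x ≤ N.cost x.E x.G := by
  have h1 := Finset.sum_nonpos fun i (_ : i ∈ Finset.univ) =>
    mul_nonpos_of_nonneg_of_nonpos (hmu i) (hx.power i)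
  have h2 := Finset.sum_nonpos fun i (_ : i ∈ Finset.univ) =>
    mul_nonpos_of_nonneg_of_nonpos (hlam i) (hx.band i)
  rw [lagrangian]
  linarith

theorem isDualOptimal_of_cost_le (N : CoopNetwork K) {lam mu : Fin 2 → ℝ}
    (hlam : ∀ i, 0 ≤ lam i) (hmu : ∀ i, 0 ≤ mu i) {x : CoopDecision K} (hx : N.IsFeasible x)
    (h : ∀ y, N.InDomain y → N.cost x.E x.G ≤ N.lagrangian lam mu y) :
    N.IsDualOptimal lam mu := by
  refine ⟨hlam, hmu, fun lam' mu' hlam' hmu' => ?_⟩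
  calc N.dualFun lam' mu' ≤ (N.lagrangian lam' mu' x : ℝ) := iInf_le _ (⟨x, hx.inDomain⟩ :
        {x : CoopDecision K // N.InDomain x})
    _ ≤ (N.cost x.E x.G : ℝ) := EReal.coe_le_coe_iff.2 (N.lagrangian_le_cost hlam' hmu' hx)
    _ ≤ N.dualFun lam mu := le_iInf fun y => EReal.coe_le_coe_iff.2 (h y.1 y.2)

theorem IsDualOptimal.cost_le_lagrangian {N : CoopNetwork K} {lam mu lam' mu' : Fin 2 → ℝ}
    (h : N.IsDualOptimal lam mu) (hlam' : ∀ i, 0 ≤ lam' i) (hmu' : ∀ i, 0 ≤ mu' i)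
    {c : ℝ} (h' : ∀ y, N.InDomain y → c ≤ N.lagrangian lam' mu' y)
    {y : CoopDecision K} (hy : N.InDomain y) : c ≤ N.lagrangian lam mu y := by
  have : (c : EReal) ≤ (N.lagrangian lam mu y : ℝ) :=
    calc (c : EReal) ≤ N.dualFun lam' mu' := le_iInf fun z => EReal.coe_le_coe_iff.2 (h' z.1 z.2)
      _ ≤ N.dualFun lam mu := h.2.2 lam' mu' hlam' hmu'
      _ ≤ (N.lagrangian lam mu y : ℝ) := iInf_le _ (⟨y, hy⟩ :
        {x : CoopDecision K // N.InDomain x})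
  exact EReal.coe_le_coe_iff.1 this

/-! ### Consequences of a saddle point -/

/-- `x` is optimal, `lam` and `mu` are nonnegative, and the Lagrangian is bounded below by the
optimal value: the Karush-Kuhn-Tucker conditions in saddle point form. -/
structure IsSaddle (N : CoopNetwork K) (lam mu : Fin 2 → ℝ) (x : CoopDecision K) : Prop where
  optimal : N.IsOptimal x
  lam_nonneg : ∀ i, 0 ≤ lam i
  mu_nonneg : ∀ i, 0 ≤ mu i
  le_lagrangian : ∀ y, N.InDomain y → N.cost x.E x.G ≤ N.lagrangian lam mu y

namespace IsSaddle

variable {N : CoopNetwork K} {lam mu : Fin 2 → ℝ} {x : CoopDecision K}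

theorem lagrangian_le (h : N.IsSaddle lam mu x) {y : CoopDecision K} (hy : N.InDomain y) :
    N.lagrangian lam mu x ≤ N.lagrangian lam mu y :=
  (N.lagrangian_le_cost h.lam_nonneg h.mu_nonneg h.optimal.1).trans (h.le_lagrangian y hy)

theorem complementary (h : N.IsSaddle lam mu x) (i : Fin 2) :
    mu i * N.powerExcess x i = 0 ∧ lam i * N.bandExcess x i = 0 := by
  have h1 : ∀ i, mu i * N.powerExcess x i ≤ 0 := fun i =>
    mul_nonpos_of_nonneg_of_nonpos (h.mu_nonneg i) (h.optimal.1.power i)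
  have h2 : ∀ i, lam i * N.bandExcess x i ≤ 0 := fun i =>
    mul_nonpos_of_nonneg_of_nonpos (h.lam_nonneg i) (h.optimal.1.band i)
  have h3 := h.le_lagrangian x h.optimal.1.inDomain
  rw [lagrangian, Fin.sum_univ_two, Fin.sum_univ_two] at h3
  have := h1 0; have := h1 1; have := h2 0; have := h2 1
  revert i
  refine Fin.forall_fin_two.2 ⟨⟨?_, ?_⟩, ?_, ?_⟩ <;> linarith

/-- At a station whose power is free no energy is bought. -/
theorem purchase_eq_zero (h : N.IsSaddle lam mu x) (halphaE : ∀ i, 0 < N.alphaE i)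
    (halphaG : ∀ i, 0 < N.alphaG i) (hgam : ∀ i, 0 < N.gam i) (hEbar : ∀ i, 0 ≤ N.Ebar i)
    {i : Fin 2} (hi : mu i = 0) : x.E i = 0 ∧ x.G i = 0 := by
  have hd := h.optimal.1.inDomain
  have hy : N.InDomain { x with E := Function.update x.E i 0, G := Function.update x.G i 0 } := by
    refine { hd with E_nonneg := fun j => ?_, G_nonneg := fun j => ?_, E_le := fun j => ?_ } <;>
      by_cases hj : j = i
    · subst hj; simp
    · simpa [hj] using hd.E_nonneg j
    · subst hj; simp
    · simpa [hj] using hd.G_nonneg j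
    · subst hj; simpa using hEbar j
    · simpa [hj] using hd.E_le j
  have hle := h.lagrangian_le hy
  have hE := hd.E_nonneg i
  have hG := hd.G_nonneg i
  have key : N.gam i * (N.alphaE i * x.E i + N.alphaG i * x.G i) ≤ 0 := by
    simp only [lagrangian, cost, powerExcess, bandExcess, Fin.sum_univ_two] at hle
    fin_cases i
    · simp at hle hi ⊢
      simp [hi] at hle
      linarith
    · simp at hle hi ⊢
      simp [hi] at hle
      linarith
  have hE' := mul_nonneg (halphaE i).le hE
  have hG' := mul_nonneg (halphaG i).le hG
  have hsum : N.alphaE i * x.E i + N.alphaG i * x.G i ≤ 0 :=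
    nonpos_of_mul_nonpos_right key (hgam i)
  constructor
  · exact (mul_eq_zero.1 (by linarith : N.alphaE i * x.E i = 0)).resolve_left (halphaE i).ne'
  · exact (mul_eq_zero.1 (by linarith : N.alphaG i * x.G i = 0)).resolve_left (halphaG i).ne'

/-- A station whose power has a positive price gives nothing to a station whose power is free. -/
theorem transfer_eq_zero (h : N.IsSaddle lam mu x) {i : Fin 2} (hi : mu i = 0)
    (hi' : 0 < mu (otherBS i)) : x.e (otherBS i) = 0 := by
  have hd := h.optimal.1.inDomain
  have hy : N.InDomain { x with e := Function.update x.e (otherBS i) 0 } := by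
    refine { hd with e_nonneg := fun j => ?_ }
    by_cases hj : j = otherBS i
    · subst hj; simp
    · simpa [hj] using hd.e_nonneg j
  have hle := h.lagrangian_le hy
  have key : mu (otherBS i) * x.e (otherBS i) ≤ 0 := by
    simp only [lagrangian, cost, powerExcess, bandExcess, Fin.sum_univ_two, otherBS_zero,
      otherBS_one] at hle
    fin_cases i
    · simp [otherBS_zero] at hle hi ⊢
      simp [hi] at hle
      linarith
    · simp [otherBS_one] at hle hi ⊢
      simp [hi] at hle
      linarith
  exact le_antisymm (nonpos_of_mul_nonpos_right key hi') (hd.e_nonneg _)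

/-- A station whose power is free has no power demand: neither station buys energy for it, and two
stations with free power cannot feed each other because transfers do not amplify energy. -/
theorem demand_eq_zero (h : N.IsSaddle lam mu x) (halphaE : ∀ i, 0 < N.alphaE i)
    (halphaG : ∀ i, 0 < N.alphaG i) (hgam : ∀ i, 0 < N.gam i) (hEbar : ∀ i, 0 ≤ N.Ebar i)
    (hPc : ∀ i, 0 ≤ N.Pc i) (hbetaE1 : N.betaE ≤ 1) {i : Fin 2} (hi : mu i = 0) :
    ∑ k, x.p i k = 0 ∧ N.powerExcess x i = 0 := by
  have hd := h.optimal.1.inDomain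
  have hsum : ∀ j, 0 ≤ ∑ k, x.p j k := fun j => Finset.sum_nonneg fun k _ => hd.p_nonneg j k
  obtain ⟨hE, hG⟩ := h.purchase_eq_zero halphaE halphaG hgam hEbar hi
  have hpow := h.optimal.1.power i
  have := hsum i; have := hPc i; have := hd.e_nonneg i
  rcases (h.mu_nonneg (otherBS i)).eq_or_lt with hi' | hi'
  · obtain ⟨hE', hG'⟩ := h.purchase_eq_zero halphaE halphaG hgam hEbar hi'.symm
    have hpow' := h.optimal.1.power (otherBS i)
    have hinv : otherBS (otherBS i) = i := by fin_cases i <;> rfl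
    have := hsum (otherBS i); have := hPc (otherBS i); have := hd.e_nonneg (otherBS i)
    rw [powerExcess, hE, hG] at hpow
    rw [powerExcess, hE', hG', hinv] at hpow'
    have h1 : N.betaE * x.e i ≤ x.e i := mul_le_of_le_one_left (by assumption) hbetaE1
    have h2 : N.betaE * x.e (otherBS i) ≤ x.e (otherBS i) :=
      mul_le_of_le_one_left (by assumption) hbetaE1
    refine ⟨by linarith, ?_⟩
    rw [powerExcess, hE, hG]
    linarith
  · have he := h.transfer_eq_zero hi hi'
    rw [powerExcess, hE, hG, he] at hpow
    refine ⟨by linarith, ?_⟩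
    rw [powerExcess, hE, hG, he]
    linarith

theorem terminal_isMin (h : N.IsSaddle lam mu x) (i : Fin 2) (k : K i) (b' p' : ℝ)
    (hb' : 0 ≤ b') (hp' : 0 ≤ p')
    (hrate : N.r i k ≤ b' * Real.logb 2 (1 + N.g i k * p' / (b' * N.N0))) :
    lam i * x.b i k + mu i * x.p i k ≤ lam i * b' + mu i * p' := by
  classical
  have hd := h.optimal.1.inDomain
  obtain ⟨up, hup⟩ : ∃ up : (∀ j, K j → ℝ) → ℝ → ∀ j, K j → ℝ, ∀ a c,
      up a c = Function.update a i (Function.update (a i) k c) := ⟨_, fun _ _ => rfl⟩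
  have hself : ∀ a c, up a c i k = c := fun a c => by simp [hup]
  have hne : ∀ a c j, j ≠ i → up a c j = a j := fun a c j hj => by simp [hup, hj]
  have hne' : ∀ a c l, l ≠ k → up a c i l = a i l := fun a c l hl => by simp [hup, hl]
  have hsum : ∀ a c, ∑ l, up a c i l = (∑ l, a i l) + (c - a i k) := fun a c => by
    rw [← Finset.add_sum_erase _ (up a c i) (Finset.mem_univ k),
      ← Finset.add_sum_erase _ (a i) (Finset.mem_univ k), hself,
      Finset.sum_congr rfl fun l hl => hne' a c l (Finset.ne_of_mem_erase hl)]
    ring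
  have hall : ∀ (P : ∀ j, K j → Prop), P i k → (∀ l, l ≠ k → P i l) →
      (∀ j, j ≠ i → ∀ l, P j l) → ∀ j l, P j l := by
    intro P h1 h2 h3 j l
    by_cases hj : j = i
    · subst hj
      by_cases hl : l = k
      · rwa [hl]
      · exact h2 l hl
    · exact h3 j hj l
  have hy : N.InDomain { x with b := up x.b b', p := up x.p p' } := by
    refine { hd with b_nonneg := hall _ ?_ ?_ ?_, p_nonneg := hall _ ?_ ?_ ?_,
                     rate := hall _ ?_ ?_ ?_ }
    · simpa only [hself] using hb'
    · intro l hl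
      simpa only [hne' _ _ l hl] using hd.b_nonneg i l
    · intro j hj l
      simpa only [hne _ _ j hj] using hd.b_nonneg j l
    · simpa only [hself] using hp'
    · intro l hl
      simpa only [hne' _ _ l hl] using hd.p_nonneg i l
    · intro j hj l
      simpa only [hne _ _ j hj] using hd.p_nonneg j l
    · simpa only [hself] using hrate
    · intro l hl
      simpa only [hne' _ _ l hl] using hd.rate i l
    · intro j hj l
      simpa only [hne _ _ j hj] using hd.rate j l
  have hle := h.lagrangian_le hy
  have hP : ∀ j, ∑ l, up x.p p' j l = (∑ l, x.p j l) + if j = i then p' - x.p i k else 0 := by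
    intro j
    by_cases hj : j = i
    · subst hj
      rw [hsum, if_pos rfl]
    · rw [hne _ _ j hj, if_neg hj, add_zero]
  have hB : ∀ j, ∑ l, up x.b b' j l = (∑ l, x.b j l) + if j = i then b' - x.b i k else 0 := by
    intro j
    by_cases hj : j = i
    · subst hj
      rw [hsum, if_pos rfl]
    · rw [hne _ _ j hj, if_neg hj, add_zero]
  have h1 : ∑ j, mu j * (if j = i then p' - x.p i k else 0) = mu i * (p' - x.p i k) := by simp
  have h2 : ∑ j, lam j * (if j = i then b' - x.b i k else 0) = lam i * (b' - x.b i k) := by simp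
  simp only [lagrangian, powerExcess, bandExcess, hP, hB, Fin.sum_univ_two] at hle h1 h2
  linarith

theorem mu_pos (h : N.IsSaddle lam mu x) (halphaE : ∀ i, 0 < N.alphaE i)
    (halphaG : ∀ i, 0 < N.alphaG i) (hgam : ∀ i, 0 < N.gam i) (hEbar : ∀ i, 0 ≤ N.Ebar i)
    (hPc : ∀ i, 0 ≤ N.Pc i) (hbetaE1 : N.betaE ≤ 1) (hN0 : 0 < N.N0)
    (hg : ∀ i k, 0 < N.g i k) (hr : ∀ i k, 0 < N.r i k) (i : Fin 2) (k : K i) : 0 < mu i := by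
  refine (h.mu_nonneg i).lt_of_ne fun hi => ?_
  have hd := h.optimal.1.inDomain
  have hs := (h.demand_eq_zero halphaE halphaG hgam hEbar hPc hbetaE1 hi.symm).1
  have hb := band_pos_of_rate (hr i k) (hd.b_nonneg i k) (hd.rate i k)
  have hpk : 0 < x.p i k := (power_pos (hg i k) hN0 (hr i k) hb).trans_le
    (power_ge_of_rate (hg i k) hN0 hb (hd.p_nonneg i k) (hd.rate i k))
  have := Finset.single_le_sum (f := fun k => x.p i k) (fun k _ => hd.p_nonneg i k)
    (Finset.mem_univ k)
  linarith

theorem energyOptimal (h : N.IsSaddle lam mu x) (halphaE : ∀ i, 0 < N.alphaE i)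
    (halphaG : ∀ i, 0 < N.alphaG i) (hgam : ∀ i, 0 < N.gam i) (hEbar : ∀ i, 0 ≤ N.Ebar i)
    (hPc : ∀ i, 0 ≤ N.Pc i) (hbetaE1 : N.betaE ≤ 1) : N.EnergyOptimal x.p x.E x.G x.e := by
  have hd := h.optimal.1.inDomain
  refine ⟨⟨fun i => ?_, hd.E_nonneg, hd.E_le, hd.G_nonneg, hd.e_nonneg⟩, fun E' G' e' h' => ?_⟩
  · have hz : N.powerExcess x i = 0 := by
      rcases mul_eq_zero.1 (h.complementary i).1 with hi | hi
      · exact (h.demand_eq_zero halphaE halphaG hgam hEbar hPc hbetaE1 hi).2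
      · exact hi
    exact sub_eq_zero.1 hz
  · exact h.optimal.2 { x with E := E', G := G', e := e' }
      ⟨{ hd with E_nonneg := h'.E_nonneg, E_le := h'.E_le, G_nonneg := h'.G_nonneg,
                 e_nonneg := h'.e_nonneg },
        fun i => (sub_eq_zero.2 (h'.balance i)).le, h.optimal.1.band⟩

/-- With a positive price of bandwidth the band constraint is tight, which determines the shared
bandwidth as soon as sharing is one-way. -/
theorem share_eq (h : N.IsSaddle lam mu x) (hbetaB : N.betaB = 0 ∨ N.betaB = 1) {i : Fin 2}
    (hi : 0 < lam i) (hw : x.w 0 * x.w 1 = 0) : x.w i = max (N.W i - ∑ k, x.b i k) 0 := by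
  have hd := h.optimal.1.inDomain
  have hz := (mul_eq_zero.1 (h.complementary i).2).resolve_left hi.ne'
  have h1 := hd.w_nonneg i
  have h2 := hd.w_nonneg (otherBS i)
  rw [bandExcess] at hz
  rcases hbetaB with hβ | hβ <;> rw [hβ] at hz
  · rw [max_eq_left (by linarith)]
    linarith
  · have hw' : x.w i = 0 ∨ x.w (otherBS i) = 0 := by
      rcases mul_eq_zero.1 hw with h0 | h0 <;> fin_cases i <;> simp_all [otherBS_zero, otherBS_one]
    rcases hw' with h0 | h0
    · rw [max_eq_right (by linarith), h0]
    · rw [max_eq_left (by linarith)]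
      linarith

end IsSaddle

/-- If the bandwidth allocation of some feasible decision is kept, then sharing exactly the positive
part of each surplus is feasible as well. -/
theorem IsFeasible.band_of_share_eq {N : CoopNetwork K} (hbetaB : N.betaB = 0 ∨ N.betaB = 1)
    {x y : CoopDecision K} (hx : N.IsFeasible x) (hb : y.b = x.b)
    (hw : ∀ i, y.w i = max (N.W i - ∑ k, y.b i k) 0) (i : Fin 2) : N.bandExcess y i ≤ 0 := by
  have h1 := hx.band i
  have h2 := hx.band (otherBS i)
  have hinv : otherBS (otherBS i) = i := by fin_cases i <;> rfl
  have h3 := hx.inDomain.w_nonneg i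
  have h4 := hx.inDomain.w_nonneg (otherBS i)
  rw [bandExcess] at h1 h2
  rw [bandExcess, hw, hw, hb]
  rw [hinv] at h2
  rcases hbetaB with hβ | hβ <;> rw [hβ] at h1 h2 ⊢
  · rw [max_eq_left (a := N.W i - ∑ k, x.b i k) (by linarith)]
    linarith
  · have h5 := le_max_left (N.W (otherBS i) - ∑ k, x.b (otherBS i) k) 0
    have h6 := le_max_right (N.W (otherBS i) - ∑ k, x.b (otherBS i) k) 0
    rcases max_cases (N.W i - ∑ k, x.b i k) 0 with ⟨h, -⟩ | ⟨h, -⟩ <;> rw [h] <;> linarith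

end CoopNetwork

theorem proposition4p1 {K : Fin 2 → Type*} [∀ i, Fintype (K i)] (N : CoopNetwork K)
    (hW : ∀ i, 0 < N.W i) (hEbar : ∀ i, 0 ≤ N.Ebar i) (hPc : ∀ i, 0 ≤ N.Pc i)
    (halphaE : ∀ i, 0 < N.alphaE i) (halphaG : ∀ i, 0 < N.alphaG i)
    (hgam : ∀ i, 0 < N.gam i)
    (hbetaE0 : 0 ≤ N.betaE) (hbetaE1 : N.betaE ≤ 1) (hbetaB : N.betaB = 0 ∨ N.betaB = 1)
    (hN0 : 0 < N.N0) (hg : ∀ i k, 0 < N.g i k) (hr : ∀ i k, 0 < N.r i k) :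
    -- the problem and its dual are solvable
    (∃ x, N.IsOptimal x) ∧ (∃ lam mu, N.IsDualOptimal lam mu) ∧
    ∀ lam mu : Fin 2 → ℝ, N.IsDualOptimal lam mu →
      -- every optimal solution has the stated form
      (∀ x, N.IsOptimal x →
        (∀ i k, 0 < mu i ∧ x.b i k = N.waterBand lam mu i k ∧
          x.p i k = N.ratePower i k (x.b i k)) ∧
        (∀ i, Nonempty (K i) → x.w 0 * x.w 1 = 0 →
          x.w i = max (N.W i - ∑ k, x.b i k) 0) ∧
        N.EnergyOptimal x.p x.E x.G x.e) ∧
      -- everything of the stated form is an optimal solution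
      (∀ x : CoopDecision K,
        (∀ i k, x.b i k = N.waterBand lam mu i k ∧
          x.p i k = N.ratePower i k (x.b i k)) →
        (∀ i, x.w i = max (N.W i - ∑ k, x.b i k) 0) →
        N.EnergyOptimal x.p x.E x.G x.e →
        N.IsOptimal x) := by
  have hbB : N.betaB ≤ 1 := by rcases hbetaB with h | h <;> norm_num [h]
  have hslater := N.exists_slater hW hEbar hPc hN0 hg hr
  obtain ⟨x₁, hd₁, hp₁, hb₁⟩ := hslater
  obtain ⟨x₀, hx₀⟩ := N.exists_isOptimal hPc halphaE halphaG hgam hbetaE1 hbB hN0 hg hr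
    ⟨hd₁, fun i => (hp₁ i).le, fun i => (hb₁ i).le⟩
  have hmult := fun {x} (hx : N.IsOptimal x) =>
    N.exists_multipliers hN0 hg hr ⟨x₁, hd₁, hp₁, hb₁⟩ hx
  refine ⟨⟨x₀, hx₀⟩, ?_, fun lam mu hdual => ?_⟩
  · obtain ⟨lam, mu, hlam, hmu, h⟩ := hmult hx₀
    exact ⟨lam, mu, N.isDualOptimal_of_cost_le hlam hmu hx₀.1 h⟩
  · have hsaddle : ∀ x, N.IsOptimal x → N.IsSaddle lam mu x := fun x hx => by
      obtain ⟨lam', mu', hlam', hmu', h⟩ := hmult hx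
      exact ⟨hx, hdual.1, hdual.2.1, fun y hy => hdual.cost_le_lagrangian hlam' hmu' h hy⟩
    have hform : ∀ x, N.IsOptimal x → ∀ i k, 0 < mu i ∧ 0 < lam i ∧
        x.b i k = N.waterBand lam mu i k ∧ x.p i k = N.ratePower i k (x.b i k) := by
      intro x hx i k
      have hs := hsaddle x hx
      have hmu := hs.mu_pos halphaE halphaG hgam hEbar hPc hbetaE1 hN0 hg hr i k
      exact ⟨hmu, waterfilling_of_isMin (hg i k) hN0 (hr i k) hmu (hx.1.inDomain.b_nonneg i k)
        (hx.1.inDomain.p_nonneg i k) (hx.1.inDomain.rate i k) (hs.terminal_isMin i k)⟩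
    refine ⟨fun x hx => ⟨fun i k => ?_, fun i ⟨k⟩ hw => ?_, ?_⟩, fun x hbp hw hE => ?_⟩
    · exact ⟨(hform x hx i k).1, (hform x hx i k).2.2⟩
    · exact (hsaddle x hx).share_eq hbetaB (hform x hx i k).2.1 hw
    · exact (hsaddle x hx).energyOptimal halphaE halphaG hgam hEbar hPc hbetaE1
    · -- The formulas force the allocation of `x` to agree with that of the optimal `x₀`.
      have hb : x.b = x₀.b := by
        ext i k
        rw [(hbp i k).1, (hform x₀ hx₀ i k).2.2.1]
      have hp : x.p = x₀.p := by
        ext i k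
        rw [(hbp i k).2, (hform x₀ hx₀ i k).2.2.2, hb]
      have hd := hx₀.1.inDomain
      have hE₀ := (hsaddle x₀ hx₀).energyOptimal halphaE halphaG hgam hEbar hPc hbetaE1
      refine ⟨⟨⟨hE.1.E_nonneg, hE.1.G_nonneg, hE.1.e_nonneg, fun i => ?_, ?_, ?_, hE.1.E_le, ?_⟩,
        fun i => (sub_eq_zero.2 (hE.1.balance i)).le,
        hx₀.1.band_of_share_eq hbetaB hb hw⟩, fun y hy => ?_⟩
      · rw [hw]
        exact le_max_right _ _
      · rw [hb]
        exact hd.b_nonneg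
      · rw [hp]
        exact hd.p_nonneg
      · rw [hb, hp]
        exact hd.rate
      · exact (hE.2 _ _ _ (hp ▸ hE₀.1)).trans (hx₀.2 y hy)
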